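/- Let $\mathbb R^{n+1}_1$ be $\mathbb R^{n+1}$ with the Lorentzian product $\langle X,Y\rangle=-x_0y_0+x_1y_1+\dots+x_ny_n$. A spacelike hypersurface is a smooth immersion $x:M^n\to\mathbb R^{n+1}_1$ of an $n$-dimensional smooth manifold whose induced metric is positive definite. Let $N$ be a smooth unit normal field along $x$ (so $\langle N,N\rangle=-1$), and let $A$ be the shape operator, defined by $dN=-dx\circ A$. The principal curvatures at a point are the eigenvalues of $A$ there, the principal spaces are its eigenspaces, and the multiplicities are their dimensions. A curvature surface is a connected smooth (injectively immersed) submanifold $S$ of $M$ such that for each $p\in S$ the tangent space $T_pS$ is equal to a principal space of $A$ at $p$. The hypersurface is Dupin if along each curvature surface the associated principal curvature is constant; it is proper Dupin if, in addition, the number of distinct principal curvatures is constant on $M$. Theorem. Let $r\ge 1$ and let $v_1,\dots,v_r$ be positive integers with $v_1+\dots+v_r=n$. Then there exists a proper spacelike Dupin hypersurface $x:M^n\to\mathbb R^{n+1}_1$, with $M$ non-empty and connected, which has $r$ distinct principal curvatures with respective multiplicities $v_1,\dots,v_r$: there are smooth functions $\kappa_1,\dots,\kappa_r:M\to\mathbb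 R$ such that at each $p\in M$ the numbers $\kappa_1(p),\dots,\kappa_r(p)$ are pairwise distinct, are exactly the principal curvatures of $x$ at $p$, and have multiplicities $v_1,\dots,v_r$ respectively. -/

import Mathlib

open scoped Manifold ContDiff

noncomputable section

namespace Lorentz

/-- The underlying smooth vector space of the Lorentz space `ℝ^{n+1}_1`. Its Euclidean norm is used
only for the topology and the differentiable structure; its metric is `lorentzForm`. -/
abbrev LorentzSpace (n : ℕ) : Type := EuclideanSpace ℝ (Fin (n + 1))

/-- The Lorentzian product `⟨X, Y⟩₁ = - x₀ y₀ + x₁ y₁ + ⋯ + xₙ yₙ` on `ℝ^{n+1}_1`. -/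
def lorentzForm (n : ℕ) : LinearMap.BilinForm ℝ (LorentzSpace n) :=
  LinearMap.mk₂ ℝ (fun X Y => -(X 0 * Y 0) + ∑ i : Fin n, X i.succ * Y i.succ)
    (fun X X' Y => by simp only [PiLp.add_apply, add_mul, Finset.sum_add_distrib]; ring)
    (fun c X Y => by
      simp only [PiLp.smul_apply, smul_eq_mul, mul_add, Finset.mul_sum, mul_assoc, mul_neg])
    (fun X Y Y' => by simp only [PiLp.add_apply, mul_add, Finset.sum_add_distrib]; ring)
    (fun c X Y => by
      simp only [PiLp.smul_apply, smul_eq_mul, mul_add, Finset.mul_sum, mul_left_comm c, mul_neg])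

theorem lorentzForm_apply {n : ℕ} (X Y : LorentzSpace n) :
    lorentzForm n X Y = -(X 0 * Y 0) + ∑ i : Fin n, X i.succ * Y i.succ := rfl

variable {n : ℕ} {M : Type} [TopologicalSpace M] [ChartedSpace (EuclideanSpace ℝ (Fin n)) M]

/-- The differential at `p` of a vector-valued map `f : M → ℝ^{n+1}_1`, with all tangent spaces of
the vector space `ℝ^{n+1}_1` identified with `ℝ^{n+1}_1`. -/
def differential (f : M → LorentzSpace n) (p : M) :
    TangentSpace (𝓡 n) p →ₗ[ℝ] LorentzSpace n :=
  (mfderiv (𝓡 n) 𝓘(ℝ, LorentzSpace n) f p).toLinearMap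

/-- `x : Mⁿ → ℝ^{n+1}_1` is a (smooth, immersed) spacelike hypersurface: the metric induced by `x`
is positive definite. In particular `dx` is injective at every point. -/
structure IsSpacelikeHypersurface (x : M → LorentzSpace n) : Prop where
  smooth : ContMDiff (𝓡 n) 𝓘(ℝ, LorentzSpace n) ∞ x
  spacelike : ∀ (p : M) (v : TangentSpace (𝓡 n) p), v ≠ 0 →
    0 < lorentzForm n (differential x p v) (differential x p v)

/-- `N` is a smooth field of (necessarily timelike) unit normal vectors along `x`. -/
structure IsUnitNormal (x N : M → LorentzSpace n) : Prop where
  smooth : ContMDiff (𝓡 n) 𝓘(ℝ, LorentzSpace n) ∞ N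
  unit : ∀ p : M, lorentzForm n (N p) (N p) = -1
  normal : ∀ (p : M) (v : TangentSpace (𝓡 n) p), lorentzForm n (N p) (differential x p v) = 0

open Classical in
/-- The shape operator `A` of `x` at `p` with respect to the unit normal `N`: the endomorphism of
`T_p M` with `dN = - dx ∘ A`. It exists by `exists_shapeOperator`, and it is unique because `dx` is
injective. -/
def shapeOperator (x N : M → LorentzSpace n) (p : M) : Module.End ℝ (TangentSpace (𝓡 n) p) :=
  if h : ∃ A : Module.End ℝ (TangentSpace (𝓡 n) p),
      ∀ v, differential x p (A v) = -differential N p v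
  then h.choose else 0

theorem lorentzForm_comm (X Y : LorentzSpace n) : lorentzForm n X Y = lorentzForm n Y X := by
  simp only [lorentzForm_apply, mul_comm]

theorem IsSpacelikeHypersurface.injective {x : M → LorentzSpace n}
    (hx : IsSpacelikeHypersurface x) (p : M) : Function.Injective (differential x p) := by
  rw [← LinearMap.ker_eq_bot, LinearMap.ker_eq_bot']
  intro v hv
  by_contra h
  have := hx.spacelike p v h
  simp [hv] at this

theorem IsUnitNormal.differential_orthogonal {x N : M → LorentzSpace n}
    (hN : IsUnitNormal x N) (p : M) (v : TangentSpace (𝓡 n) p) :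
    lorentzForm n (N p) (differential N p v) = 0 := by
  have hd : HasMFDerivAt (𝓡 n) 𝓘(ℝ, LorentzSpace n) N p
      (mfderiv (𝓡 n) 𝓘(ℝ, LorentzSpace n) N p) :=
    ((hN.smooth p).mdifferentiableAt (by simp)).hasMFDerivAt
  let B := (lorentzForm n).toContinuousBilinearMap
  have hB : ∀ a b, B a b = lorentzForm n a b := fun a b => rfl
  have hQ : HasFDerivAt (fun w : LorentzSpace n => B w w) _ (N p) :=
    B.hasFDerivAt_of_bilinear (hasFDerivAt_id (N p)) (hasFDerivAt_id (N p))
  have hc := hQ.hasMFDerivAt.comp p hd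
  have hk : (fun w : LorentzSpace n => B w w) ∘ N = fun _ => (-1 : ℝ) := by
    funext q; simp [hB, hN.unit q]
  rw [hk] at hc
  have h0 := hasMFDerivAt_unique hc (hasMFDerivAt_const (-1 : ℝ) p)
  have h1 := congrArg (fun L => L v) h0
  have h2 : B (N p) (differential N p v) + B (differential N p v) (N p) = 0 := h1
  rw [hB, hB, lorentzForm_comm (differential N p v)] at h2
  linarith

theorem exists_shapeOperator {x N : M → LorentzSpace n} (hx : IsSpacelikeHypersurface x)
    (hN : IsUnitNormal x N) (p : M) :
    ∃ A : Module.End ℝ (TangentSpace (𝓡 n) p),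
      ∀ v, differential x p (A v) = -differential N p v := by
  have hle : LinearMap.range (differential x p) ≤ LinearMap.ker (lorentzForm n (N p)) := by
    rintro _ ⟨v, rfl⟩
    exact hN.normal p v
  have hf : Module.finrank ℝ (TangentSpace (𝓡 n) p) = n := by
    change Module.finrank ℝ (EuclideanSpace ℝ (Fin n)) = n
    simp
  have : FiniteDimensional ℝ (TangentSpace (𝓡 n) p) :=
    inferInstanceAs (FiniteDimensional ℝ (EuclideanSpace ℝ (Fin n)))
  have hr : Module.finrank ℝ (LinearMap.range (differential x p)) = n := by
    rw [LinearMap.finrank_range_of_inj (hx.injective p), hf]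
  have hne : lorentzForm n (N p) ≠ 0 := by
    intro h
    have := hN.unit p
    simp [h] at this
  have hk : Module.finrank ℝ (LinearMap.ker (lorentzForm n (N p))) = n := by
    have h1 := (lorentzForm n (N p)).finrank_range_add_finrank_ker
    have h2 : LinearMap.range (lorentzForm n (N p)) = ⊤ :=
      LinearMap.range_eq_top.2 (LinearMap.surjective hne)
    rw [h2, finrank_top] at h1
    simp at h1
    omega
  have he := Submodule.eq_of_le_of_finrank_eq hle (hr.trans hk.symm)
  let e := LinearEquiv.ofInjective (differential x p) (hx.injective p)
  have hm : ∀ v, (-differential N p) v ∈ LinearMap.range (differential x p) := by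
    intro v
    rw [he, LinearMap.mem_ker]
    simp [hN.differential_orthogonal p v]
  refine ⟨e.symm.toLinearMap ∘ₗ (-differential N p).codRestrict _ hm, fun v => ?_⟩
  have := congrArg Subtype.val
    (e.apply_symm_apply ((-differential N p).codRestrict _ hm v))
  exact this

theorem differential_shapeOperator {x N : M → LorentzSpace n} (hx : IsSpacelikeHypersurface x)
    (hN : IsUnitNormal x N) (p : M) (v : TangentSpace (𝓡 n) p) :
    differential x p (shapeOperator x N p v) = -differential N p v := by
  have h := exists_shapeOperator hx hN p
  rw [shapeOperator, dif_pos h]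
  exact h.choose_spec v

/-- The set of principal curvatures of `x` at `p`. -/
def principalCurvatures (x N : M → LorentzSpace n) (p : M) : Set ℝ :=
  {μ | (shapeOperator x N p).HasEigenvalue μ}

/-- The principal space `D_μ = {X ∈ T_p M | A X = μ X}`. -/
def principalSpace (x N : M → LorentzSpace n) (p : M) (μ : ℝ) :
    Submodule ℝ (TangentSpace (𝓡 n) p) :=
  (shapeOperator x N p).eigenspace μ

/-- The multiplicity of `μ` as a principal curvature of `x` at `p`. -/
def principalMultiplicity (x N : M → LorentzSpace n) (p : M) (μ : ℝ) : ℕ :=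
  Module.finrank ℝ (principalSpace x N p μ)

/-- A curvature surface of `x` with associated principal curvature `μ`: a connected smooth
`k`-dimensional submanifold of `M`, given as an injective immersion `ι : S → M`, whose tangent space
at every point `q` is the principal space of the principal curvature `μ q`. -/
structure IsCurvatureSurface (x N : M → LorentzSpace n) {k : ℕ} {S : Type} [TopologicalSpace S]
    [ChartedSpace (EuclideanSpace ℝ (Fin k)) S] (ι : S → M) (μ : S → ℝ) : Prop where
  isManifold : IsManifold (𝓡 k) ∞ S
  connected : ConnectedSpace S
  smooth : ContMDiff (𝓡 k) (𝓡 n) ∞ ι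
  injective : Function.Injective ι
  immersion : ∀ q : S, Function.Injective (mfderiv (𝓡 k) (𝓡 n) ι q)
  isPrincipal : ∀ q : S, μ q ∈ principalCurvatures x N (ι q)
  tangent : ∀ q : S, (mfderiv (𝓡 k) (𝓡 n) ι q).range = principalSpace x N (ι q) (μ q)

/-- Dupin: along each curvature surface the associated principal curvature is constant. -/
def IsDupin (x N : M → LorentzSpace n) : Prop :=
  ∀ (k : ℕ) (S : Type) [TopologicalSpace S] [ChartedSpace (EuclideanSpace ℝ (Fin k)) S]
    (ι : S → M) (μ : S → ℝ), IsCurvatureSurface x N (k := k) ι μ → ∀ q q' : S, μ q = μ q'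

/-- Proper Dupin: Dupin, and the number of distinct principal curvatures is constant on `M`. -/
def IsProperDupin (x N : M → LorentzSpace n) : Prop :=
  IsDupin x N ∧ ∃ r : ℕ, ∀ p : M, (principalCurvatures x N p).encard = r

end Lorentz

end

noncomputable section

namespace Lorentz

/-! ### Iterated hyperbolic tubes -/

variable {n : ℕ} (b : Fin n → ℕ)

/-! Take `M = ℝⁿ`, split into blocks `p₀, …, p_{r-1}` of sizes `v i`; `b j` is the block of
coordinate `j`. Put `N₀ = e₀`, `N_{k+1} = h_k N_k + p_k` with `h_k = √(1 + |p_k|²)`, and `x = -(N₁ +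
⋯ + N_r)`. Each step lets the normal sweep the unit hyperboloid in the span of `N_k` and the new
block, and builds the tube with that normal.

Since `N_k` sees only blocks below `k`, both `dN_r` and `-dx` are positive combinations of the same
maps `E_i = dh_i N_i + du_i` (`blockDirection`), which are mutually orthogonal, orthogonal to `N_r`,
and positive definite on block `i`. Hence `A` is the scalar `κ_i` on block `i`, and `1/κ_i =
∑_{i≤l<r} ∏_{l<m<r} h_m⁻¹`. These radii strictly decrease in `i`, so the `κ_i` are distinct with
multiplicities `v i`.

Only heights `h_m` with `m > i` enter `κ_i`, so it is constant along block `i`. A connected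
curvature surface stays in a translate of a single block (`isDupin_tube`), which gives the Dupin
property. -/

/-- The scalar product of the `k`-th blocks of coordinates of `p` and `u`. -/
def blockInner (k : ℕ) (p u : EuclideanSpace ℝ (Fin n)) : ℝ :=
  ∑ j, if b j = k then p j * u j else 0

/-- The height `√(1 + |p_k|²)` of the point over `p_k` on the unit hyperboloid. -/
def height (k : ℕ) (p : EuclideanSpace ℝ (Fin n)) : ℝ :=
  √(1 + blockInner b k p p)

/-- The inclusion of the `k`-th block of coordinates into the Lorentz space. -/
def blockLift (k : ℕ) : EuclideanSpace ℝ (Fin n) →L[ℝ] LorentzSpace n :=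
  LinearMap.toContinuousLinearMap
    { toFun := fun u => WithLp.toLp 2 (Fin.cons 0 fun j => if b j = k then u j else 0)
      map_add' := fun u v => by
        ext j
        refine Fin.cases (by simp) (fun j => ?_) j
        by_cases h : b j = k <;> simp [h]
      map_smul' := fun c u => by
        ext j
        refine Fin.cases (by simp) (fun j => ?_) j
        by_cases h : b j = k <;> simp [h] }

@[simp] theorem blockLift_zero (k : ℕ) (u : EuclideanSpace ℝ (Fin n)) : blockLift b k u 0 = 0 :=
  rfl

@[simp] theorem blockLift_succ (k : ℕ) (u : EuclideanSpace ℝ (Fin n)) (j : Fin n) :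
    blockLift b k u j.succ = if b j = k then u j else 0 := rfl

/-- The unit normal of the hypersurface obtained after `k` hyperbolic tube constructions. -/
def tubeNormal : ℕ → EuclideanSpace ℝ (Fin n) → LorentzSpace n
  | 0, _ => EuclideanSpace.single 0 1
  | k + 1, p => height b k p • tubeNormal k p + blockLift b k p

/-- The hypersurface obtained after `k` hyperbolic tube constructions, each of radius `-1`. -/
def tube : ℕ → EuclideanSpace ℝ (Fin n) → LorentzSpace n
  | 0, _ => 0
  | k + 1, p => tube k p - tubeNormal b (k + 1) p

/-- The differential of `height b k` at `p`. -/
def heightDeriv (k : ℕ) (p : EuclideanSpace ℝ (Fin n)) : EuclideanSpace ℝ (Fin n) →L[ℝ] ℝ :=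
  (height b k p)⁻¹ • ∑ j, (if b j = k then p j else 0) • EuclideanSpace.proj j

theorem heightDeriv_apply (k : ℕ) (p u : EuclideanSpace ℝ (Fin n)) :
    heightDeriv b k p u = (height b k p)⁻¹ * blockInner b k p u := by
  simp only [heightDeriv, blockInner, smul_apply, sum_apply, smul_eq_mul]
  congr 1
  refine Finset.sum_congr rfl fun j _ => ?_
  split_ifs <;> simp

/-- The direction of `dx` and `dN` on the `i`-th block of coordinates. -/
def blockDirection (i : ℕ) (p : EuclideanSpace ℝ (Fin n)) :
    EuclideanSpace ℝ (Fin n) →L[ℝ] LorentzSpace n :=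
  (heightDeriv b i p).smulRight (tubeNormal b i p) + blockLift b i

theorem blockDirection_apply (i : ℕ) (p u : EuclideanSpace ℝ (Fin n)) :
    blockDirection b i p u = heightDeriv b i p u • tubeNormal b i p + blockLift b i u := rfl

theorem blockInner_self_nonneg (k : ℕ) (p : EuclideanSpace ℝ (Fin n)) :
    0 ≤ blockInner b k p p :=
  Finset.sum_nonneg fun j _ => by
    split_ifs
    exacts [mul_self_nonneg _, le_rfl]

theorem height_pos (k : ℕ) (p : EuclideanSpace ℝ (Fin n)) : 0 < height b k p :=
  Real.sqrt_pos.2 (by linarith [blockInner_self_nonneg b k p])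

theorem height_sq (k : ℕ) (p : EuclideanSpace ℝ (Fin n)) :
    height b k p ^ 2 = 1 + blockInner b k p p :=
  Real.sq_sqrt (by linarith [blockInner_self_nonneg b k p])

theorem contDiff_height (k : ℕ) : ContDiff ℝ ∞ (height b k) := by
  refine ContDiff.sqrt ?_ fun p => by linarith [blockInner_self_nonneg b k p]
  refine contDiff_const.add (ContDiff.sum fun j _ => ?_)
  split_ifs <;> fun_prop

theorem hasFDerivAt_height (k : ℕ) (p : EuclideanSpace ℝ (Fin n)) :
    HasFDerivAt (height b k) (heightDeriv b k p) p := by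
  have h : HasFDerivAt (fun p => 1 + blockInner b k p p)
      (∑ j, if b j = k then (2 * p j) • (EuclideanSpace.proj j :
        EuclideanSpace ℝ (Fin n) →L[ℝ] ℝ) else 0) p := by
    refine (HasFDerivAt.fun_sum fun j _ => ?_).const_add 1
    split_ifs
    · have := (EuclideanSpace.proj j : EuclideanSpace ℝ (Fin n) →L[ℝ] ℝ).hasFDerivAt (x := p)
      refine (this.mul this).congr_fderiv ?_
      rw [two_mul, add_smul]
      rfl
    · exact hasFDerivAt_const _ _
  refine (h.sqrt (by linarith [blockInner_self_nonneg b k p])).congr_fderiv ?_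
  rw [heightDeriv, Finset.smul_sum, Finset.smul_sum]
  refine Finset.sum_congr rfl fun j _ => ?_
  split_ifs
  · rw [smul_smul, smul_smul, height]
    congr 1
    field_simp
  · rw [zero_smul, smul_zero, smul_zero]

theorem contDiff_tubeNormal (k : ℕ) : ContDiff ℝ ∞ (tubeNormal b k) := by
  induction k with
  | zero => exact contDiff_const
  | succ k ih => exact ((contDiff_height b k).smul ih).add (blockLift b k).contDiff

theorem contDiff_tube (k : ℕ) : ContDiff ℝ ∞ (tube b k) := by
  induction k with
  | zero => exact contDiff_const
  | succ k ih => exact ih.sub (contDiff_tubeNormal b (k + 1))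

/-! ### Differentials of the normal and of the tube -/

/-- The factor of `dN` on the `i`-th block of coordinates. -/
def normalFactor (i k : ℕ) (p : EuclideanSpace ℝ (Fin n)) : ℝ :=
  ∏ m ∈ Finset.Ico (i + 1) k, height b m p

/-- The factor of `-dx` on the `i`-th block of coordinates. -/
def tubeFactor (i k : ℕ) (p : EuclideanSpace ℝ (Fin n)) : ℝ :=
  ∑ l ∈ Finset.Ico i k, normalFactor b i (l + 1) p

theorem normalFactor_pos (i k : ℕ) (p : EuclideanSpace ℝ (Fin n)) : 0 < normalFactor b i k p :=
  Finset.prod_pos fun m _ => height_pos b m p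

theorem tubeFactor_pos {i k : ℕ} (h : i < k) (p : EuclideanSpace ℝ (Fin n)) :
    0 < tubeFactor b i k p :=
  Finset.sum_pos (fun l _ => normalFactor_pos b i (l + 1) p) (by simpa using h)

/-- By the product rule, passing from `k` to `k + 1` multiplies the old terms by `h_k` and adds
`E_k` with coefficient 1, an empty product. -/
theorem hasFDerivAt_tubeNormal (k : ℕ) (p : EuclideanSpace ℝ (Fin n)) :
    HasFDerivAt (tubeNormal b k)
      (∑ i ∈ Finset.range k, normalFactor b i k p • blockDirection b i p) p := by
  induction k with
  | zero => exact hasFDerivAt_const _ _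
  | succ k ih =>
    refine (((hasFDerivAt_height b k p).smul ih).add (blockLift b k).hasFDerivAt).congr_fderiv ?_
    symm
    rw [Finset.sum_range_succ, add_assoc, ← blockDirection, Finset.smul_sum]
    congr 1
    · refine Finset.sum_congr rfl fun i hi => ?_
      rw [normalFactor, Finset.prod_Ico_succ_top (by simpa using hi), smul_smul, mul_comm]
      rfl
    · simp [normalFactor]

theorem hasFDerivAt_tube (k : ℕ) (p : EuclideanSpace ℝ (Fin n)) :
    HasFDerivAt (tube b k)
      (-∑ i ∈ Finset.range k, tubeFactor b i k p • blockDirection b i p) p := by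
  induction k with
  | zero => simpa [tube] using hasFDerivAt_const (0 : LorentzSpace n) p
  | succ k ih =>
    refine (ih.sub (hasFDerivAt_tubeNormal b (k + 1) p)).congr_fderiv ?_
    symm
    rw [← neg_add', neg_inj, Finset.sum_range_succ, Finset.sum_range_succ, ← add_assoc,
      ← Finset.sum_add_distrib]
    congr 1
    · refine Finset.sum_congr rfl fun i hi => ?_
      rw [tubeFactor, Finset.sum_Ico_succ_top (Finset.mem_range.1 hi).le]
      exact add_smul (tubeFactor b i k p) (normalFactor b i (k + 1) p) (blockDirection b i p)
    · simp [tubeFactor]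

/-! ### Orthogonality and positivity for the Lorentzian product -/

theorem tubeNormal_succ_eq_zero {k : ℕ} {j : Fin n} (h : k ≤ b j)
    (p : EuclideanSpace ℝ (Fin n)) : tubeNormal b k p j.succ = 0 := by
  induction k with
  | zero => simp [tubeNormal]
  | succ k ih => simp [tubeNormal, ih (by omega), show b j ≠ k by omega]

theorem lorentzForm_tubeNormal_blockLift {k i : ℕ} (h : k ≤ i) (p u : EuclideanSpace ℝ (Fin n)) :
    lorentzForm n (tubeNormal b k p) (blockLift b i u) = 0 := by
  rw [lorentzForm_apply, blockLift_zero, mul_zero, neg_zero, zero_add]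
  refine Finset.sum_eq_zero fun j _ => ?_
  rw [blockLift_succ]
  split_ifs with hj
  · rw [tubeNormal_succ_eq_zero b (by omega), zero_mul]
  · rw [mul_zero]

theorem lorentzForm_blockLift_of_ne {i j : ℕ} (h : i ≠ j) (u u' : EuclideanSpace ℝ (Fin n)) :
    lorentzForm n (blockLift b i u) (blockLift b j u') = 0 := by
  rw [lorentzForm_apply, blockLift_zero, zero_mul, neg_zero, zero_add]
  refine Finset.sum_eq_zero fun l _ => ?_
  simp only [blockLift_succ]
  split_ifs <;> simp
  omega

theorem lorentzForm_blockLift (i : ℕ) (u u' : EuclideanSpace ℝ (Fin n)) :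
    lorentzForm n (blockLift b i u) (blockLift b i u') = blockInner b i u u' := by
  rw [lorentzForm_apply, blockLift_zero, zero_mul, neg_zero, zero_add]
  refine Finset.sum_congr rfl fun l _ => ?_
  simp only [blockLift_succ]
  split_ifs <;> simp

theorem lorentzForm_tubeNormal_self (k : ℕ) (p : EuclideanSpace ℝ (Fin n)) :
    lorentzForm n (tubeNormal b k p) (tubeNormal b k p) = -1 := by
  induction k with
  | zero => simp [lorentzForm_apply, tubeNormal]
  | succ k ih =>
    have h := lorentzForm_tubeNormal_blockLift b le_rfl p p (k := k)
    have h' := h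
    rw [lorentzForm_comm] at h'
    simp only [tubeNormal, map_add, map_smul, LinearMap.add_apply, LinearMap.smul_apply,
      smul_eq_mul, ih, h, h', lorentzForm_blockLift]
    linarith [height_sq b k p]

theorem lorentzForm_blockDirection_blockLift {i j : ℕ} (h : i < j)
    (p u u' : EuclideanSpace ℝ (Fin n)) :
    lorentzForm n (blockDirection b i p u) (blockLift b j u') = 0 := by
  simp [blockDirection_apply, lorentzForm_tubeNormal_blockLift b h.le,
    lorentzForm_blockLift_of_ne b h.ne]

/-- For `j = i + 1` this is the derivative of `⟨N_{i+1}, N_{i+1}⟩ = -1` in block `i`, that is `h_i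
dh_i = p_i · u_i`. Later normals only rescale `N_j` and add blocks orthogonal to `E_i`. -/
theorem lorentzForm_blockDirection_tubeNormal {i j : ℕ} (h : i < j)
    (p u : EuclideanSpace ℝ (Fin n)) :
    lorentzForm n (blockDirection b i p u) (tubeNormal b j p) = 0 := by
  induction j, h using Nat.le_induction with
  | base =>
    have h' := lorentzForm_tubeNormal_blockLift b le_rfl p u (k := i)
    rw [lorentzForm_comm] at h'
    have hp := (height_pos b i p).ne'
    have hc : blockInner b i u p = blockInner b i p u := by simp [blockInner, mul_comm]
    simp only [tubeNormal, blockDirection_apply, heightDeriv_apply, map_add, map_smul,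
      LinearMap.add_apply, LinearMap.smul_apply, smul_eq_mul, lorentzForm_tubeNormal_self,
      lorentzForm_tubeNormal_blockLift b le_rfl, h', lorentzForm_blockLift, hc]
    field_simp
    ring
  | succ j hj ih =>
    simp [tubeNormal, ih, lorentzForm_blockDirection_blockLift b (show i < j from hj)]

theorem lorentzForm_blockDirection_of_ne {i j : ℕ} (h : i ≠ j)
    (p u u' : EuclideanSpace ℝ (Fin n)) :
    lorentzForm n (blockDirection b i p u) (blockDirection b j p u') = 0 := by
  wlog hij : i < j generalizing i j u u'
  · rw [lorentzForm_comm]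
    exact this h.symm u' u (by omega)
  rw [blockDirection_apply b j, map_add, map_smul, lorentzForm_blockDirection_tubeNormal b hij,
    lorentzForm_blockDirection_blockLift b hij, smul_zero, zero_add]

theorem lorentzForm_blockDirection_self (i : ℕ) (p u : EuclideanSpace ℝ (Fin n)) :
    lorentzForm n (blockDirection b i p u) (blockDirection b i p u) =
      blockInner b i u u - heightDeriv b i p u ^ 2 := by
  have h := lorentzForm_tubeNormal_blockLift b le_rfl p u (k := i)
  have h' := h
  rw [lorentzForm_comm] at h'
  simp only [blockDirection_apply, map_add, map_smul, LinearMap.add_apply, LinearMap.smul_apply,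
    smul_eq_mul, lorentzForm_tubeNormal_self, h, h', lorentzForm_blockLift]
  ring

theorem blockInner_sq_le (i : ℕ) (p u : EuclideanSpace ℝ (Fin n)) :
    blockInner b i p u ^ 2 ≤ blockInner b i p p * blockInner b i u u := by
  simp only [blockInner, ← Finset.sum_filter, ← pow_two]
  exact Finset.sum_mul_sq_le_sq_mul_sq _ _ _

/-- Cauchy–Schwarz in block `i`: `E_i` pulls back the hyperbolic metric `|u|² - (p·u)²/h²`, bounded
below by `|u|²/h²`. -/
theorem blockInner_le_lorentzForm_blockDirection (i : ℕ) (p u : EuclideanSpace ℝ (Fin n)) :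
    blockInner b i u u ≤
      height b i p ^ 2 * lorentzForm n (blockDirection b i p u) (blockDirection b i p u) := by
  have hp := (height_pos b i p).ne'
  have h : height b i p ^ 2 * heightDeriv b i p u ^ 2 = blockInner b i p u ^ 2 := by
    rw [heightDeriv_apply]
    field_simp
  rw [lorentzForm_blockDirection_self, mul_sub, h, height_sq]
  linarith [blockInner_sq_le b i p u]

theorem lorentzForm_blockDirection_nonneg (i : ℕ) (p u : EuclideanSpace ℝ (Fin n)) :
    0 ≤ lorentzForm n (blockDirection b i p u) (blockDirection b i p u) :=
  nonneg_of_mul_nonneg_right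
    ((blockInner_self_nonneg b i u).trans (blockInner_le_lorentzForm_blockDirection b i p u))
    (pow_pos (height_pos b i p) 2)

theorem lorentzForm_blockDirection_pos {u : EuclideanSpace ℝ (Fin n)} {j : Fin n} (hj : u j ≠ 0)
    (p : EuclideanSpace ℝ (Fin n)) :
    0 < lorentzForm n (blockDirection b (b j) p u) (blockDirection b (b j) p u) := by
  have h : 0 < blockInner b (b j) u u := by
    refine Finset.sum_pos' (fun l _ => ?_) ⟨j, Finset.mem_univ j, ?_⟩
    · split_ifs
      exacts [mul_self_nonneg _, le_rfl]
    · rw [if_pos rfl]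
      exact mul_self_pos.2 hj
  exact pos_of_mul_pos_right (h.trans_le (blockInner_le_lorentzForm_blockDirection b _ p u))
    (pow_pos (height_pos b _ p) 2).le

/-! ### The tube as a spacelike hypersurface with unit normal -/

theorem differential_tube (k : ℕ) (p u : EuclideanSpace ℝ (Fin n)) :
    differential (tube b k) p u =
      -∑ i ∈ Finset.range k, tubeFactor b i k p • blockDirection b i p u := by
  have h := mfderiv_eq_fderiv.trans (hasFDerivAt_tube b k p).fderiv
  refine (congrArg (fun L : EuclideanSpace ℝ (Fin n) →L[ℝ] LorentzSpace n => L u) h).trans ?_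
  simp [sum_apply]

theorem differential_tubeNormal (k : ℕ) (p u : EuclideanSpace ℝ (Fin n)) :
    differential (tubeNormal b k) p u =
      ∑ i ∈ Finset.range k, normalFactor b i k p • blockDirection b i p u := by
  have h := mfderiv_eq_fderiv.trans (hasFDerivAt_tubeNormal b k p).fderiv
  refine (congrArg (fun L : EuclideanSpace ℝ (Fin n) →L[ℝ] LorentzSpace n => L u) h).trans ?_
  simp [sum_apply]

theorem isSpacelikeHypersurface_tube {r : ℕ} (hb : ∀ j, b j < r) :
    IsSpacelikeHypersurface (tube b r) where
  smooth := (contDiff_tube b r).contMDiff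
  spacelike := fun p (u : EuclideanSpace ℝ (Fin n)) hu => by
    obtain ⟨j, hj⟩ : ∃ j, u j ≠ 0 := by
      by_contra! h
      exact hu (PiLp.ext h)
    have h : lorentzForm n (differential (tube b r) p u) (differential (tube b r) p u) =
        ∑ i ∈ Finset.range r, tubeFactor b i r p ^ 2 *
          lorentzForm n (blockDirection b i p u) (blockDirection b i p u) := by
      rw [differential_tube]
      simp only [map_neg, LinearMap.neg_apply, map_sum, LinearMap.sum_apply, map_smul,
        LinearMap.smul_apply, smul_eq_mul]
      rw [← Finset.sum_neg_distrib]
      refine Finset.sum_congr rfl fun i hi => ?_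
      rw [Finset.sum_eq_single_of_mem i hi]
      · ring
      · intro l _ hl
        rw [lorentzForm_blockDirection_of_ne b (by tauto), mul_zero]
    rw [h]
    refine Finset.sum_pos' (fun i _ => ?_) ⟨b j, by simpa using hb j, ?_⟩
    · exact mul_nonneg (sq_nonneg _) (lorentzForm_blockDirection_nonneg b i p u)
    · exact mul_pos (pow_pos (tubeFactor_pos b (hb j) p) 2)
        (lorentzForm_blockDirection_pos b hj p)

theorem isUnitNormal_tube (r : ℕ) : IsUnitNormal (tube b r) (tubeNormal b r) where
  smooth := (contDiff_tubeNormal b r).contMDiff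
  unit := lorentzForm_tubeNormal_self b r
  normal := fun p (u : EuclideanSpace ℝ (Fin n)) => by
    rw [differential_tube, map_neg, map_sum, neg_eq_zero]
    refine Finset.sum_eq_zero fun i hi => ?_
    rw [map_smul, lorentzForm_comm,
      lorentzForm_blockDirection_tubeNormal b (by simpa using hi), smul_zero]

/-! ### Principal curvatures and principal spaces -/

/-- The radius of curvature of `tube b r` on the `i`-th block of coordinates. -/
def radius (r i : ℕ) (p : EuclideanSpace ℝ (Fin n)) : ℝ :=
  ∑ l ∈ Finset.Ico i r, (∏ m ∈ Finset.Ico (l + 1) r, height b m p)⁻¹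

theorem radius_pos {r i : ℕ} (h : i < r) (p : EuclideanSpace ℝ (Fin n)) : 0 < radius b r i p :=
  Finset.sum_pos (fun _ _ => inv_pos.2 (Finset.prod_pos fun m _ => height_pos b m p))
    (by simpa using h)

/-- Passing from `j` to a smaller `i` adds positive terms; the extra term `l = i` makes the
inequality strict. -/
theorem radius_lt {r i j : ℕ} (hij : i < j) (hj : j < r) (p : EuclideanSpace ℝ (Fin n)) :
    radius b r j p < radius b r i p := by
  refine Finset.sum_lt_sum_of_subset (i := i) (Finset.Ico_subset_Ico_left hij.le)
    (by simp; omega) (by simp; omega)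
    (inv_pos.2 (Finset.prod_pos fun m _ => height_pos b m p)) fun _ _ _ => ?_
  exact (inv_pos.2 (Finset.prod_pos fun m _ => height_pos b m p)).le

theorem contDiff_radius (r i : ℕ) : ContDiff ℝ ∞ (radius b r i) := by
  refine ContDiff.sum fun l _ => ContDiff.inv (contDiff_prod fun m _ => contDiff_height b m)
    fun p => (Finset.prod_pos fun m _ => height_pos b m p).ne'

/-- Every height `h_m` in the radius has `m > i`, so coordinates of block `i` never enter. This is
the source of the Dupin property. -/
theorem radius_congr (r i : ℕ) {p q : EuclideanSpace ℝ (Fin n)} (h : ∀ j, b j ≠ i → p j = q j) :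
    radius b r i p = radius b r i q := by
  refine Finset.sum_congr rfl fun l hl => congrArg _ (Finset.prod_congr rfl fun m hm => ?_)
  rw [Finset.mem_Ico] at hl hm
  refine congrArg (fun t => √(1 + t)) (Finset.sum_congr rfl fun j _ => ?_)
  split_ifs with hj
  · rw [h j (by omega)]
  · rfl

theorem tubeFactor_eq (r i : ℕ) (p : EuclideanSpace ℝ (Fin n)) :
    tubeFactor b i r p = radius b r i p * normalFactor b i r p := by
  rw [tubeFactor, radius, Finset.sum_mul]
  refine Finset.sum_congr rfl fun l hl => ?_
  rw [Finset.mem_Ico] at hl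
  rw [eq_inv_mul_iff_mul_eq₀ (Finset.prod_pos fun m _ => height_pos b m p).ne', mul_comm]
  exact Finset.prod_Ico_consecutive _ (by omega) (by omega)

/-- The principal curvature of `tube b r` on the `i`-th block of coordinates. -/
def curvature (r i : ℕ) (p : EuclideanSpace ℝ (Fin n)) : ℝ := (radius b r i p)⁻¹

theorem curvature_injOn (r : ℕ) (p : EuclideanSpace ℝ (Fin n)) {i j : ℕ} (hi : i < r) (hj : j < r)
    (h : curvature b r i p = curvature b r j p) : i = j := by
  have h' := inv_injective h
  rcases lt_trichotomy i j with hij | hij | hij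
  · exact absurd h' (radius_lt b hij hj p).ne'
  · exact hij
  · exact absurd h' (radius_lt b hij hi p).ne

theorem contDiff_curvature {r i : ℕ} (h : i < r) : ContDiff ℝ ∞ (curvature b r i) :=
  (contDiff_radius b r i).inv fun p => (radius_pos b h p).ne'

/-- As `dx` is injective, it suffices to compare images under `dx`: scaling block `i` by `κ_i`
scales `E_i` by `κ_i`, and `tubeFactor * κ_i = normalFactor`. -/
theorem shapeOperator_tube {r : ℕ} (hb : ∀ j, b j < r) (p u : EuclideanSpace ℝ (Fin n)) :
    shapeOperator (tube b r) (tubeNormal b r) p u =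
      WithLp.toLp 2 fun j => curvature b r (b j) p * u j := by
  have hx := isSpacelikeHypersurface_tube b hb
  refine hx.injective p ?_
  have key : ∀ i, blockDirection b i p (WithLp.toLp 2 fun j => curvature b r (b j) p * u j) =
      curvature b r i p • blockDirection b i p u := by
    intro i
    have h1 : heightDeriv b i p (WithLp.toLp 2 fun j => curvature b r (b j) p * u j) =
        curvature b r i p * heightDeriv b i p u := by
      simp only [heightDeriv_apply, blockInner, Finset.mul_sum]
      refine Finset.sum_congr rfl fun j _ => ?_
      split_ifs with hj
      · rw [hj]
        ring
      · ring
    have h2 : blockLift b i (WithLp.toLp 2 fun j => curvature b r (b j) p * u j) =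
        curvature b r i p • blockLift b i u := by
      ext j
      refine Fin.cases (by simp) (fun j => ?_) j
      by_cases hj : b j = i <;> simp [hj]
    rw [blockDirection_apply, h1, h2, blockDirection_apply, smul_add, smul_smul]
  refine (differential_shapeOperator hx (isUnitNormal_tube b r) p _).trans ?_
  rw [differential_tubeNormal]
  refine Eq.trans ?_ (differential_tube b r p _).symm
  refine congrArg _ (Finset.sum_congr rfl fun i hi => ?_)
  rw [key, smul_smul, tubeFactor_eq, curvature, mul_right_comm,
    mul_inv_cancel₀ (radius_pos b (by simpa using hi) p).ne', one_mul]

theorem mem_principalSpace_tube {r : ℕ} (hb : ∀ j, b j < r) (p u : EuclideanSpace ℝ (Fin n))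
    (μ : ℝ) : u ∈ principalSpace (tube b r) (tubeNormal b r) p μ ↔
      ∀ j, curvature b r (b j) p = μ ∨ u j = 0 := by
  have hA := shapeOperator_tube b hb p u
  refine (Module.End.mem_eigenspace_iff (M := TangentSpace (𝓡 n) p)).trans ?_
  refine (show _ ↔ (WithLp.toLp 2 fun j => curvature b r (b j) p * u j) = μ • u from
    ⟨fun h => hA.symm.trans h, fun h => hA.trans h⟩).trans ?_
  refine ⟨fun h j => ?_, fun h => PiLp.ext fun j => ?_⟩
  · have : curvature b r (b j) p * u j = μ * u j :=
      congrArg (fun w : EuclideanSpace ℝ (Fin n) => w j) h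
    simpa using this
  · have : curvature b r (b j) p * u j = μ * u j := by simpa using h j
    exact this

theorem mem_principalSpace_curvature {r : ℕ} (hb : ∀ j, b j < r) (p u : EuclideanSpace ℝ (Fin n))
    {i : ℕ} (hi : i < r) :
    u ∈ principalSpace (tube b r) (tubeNormal b r) p (curvature b r i p) ↔
      ∀ j, b j ≠ i → u j = 0 := by
  rw [mem_principalSpace_tube b hb]
  refine forall_congr' fun j => ?_
  rw [or_iff_not_imp_left, not_congr
    ⟨curvature_injOn b r p (hb j) hi, fun h => h ▸ rfl⟩]

theorem mem_principalCurvatures_tube {r : ℕ} (hb : ∀ j, b j < r) (p : EuclideanSpace ℝ (Fin n))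
    (μ : ℝ) : μ ∈ principalCurvatures (tube b r) (tubeNormal b r) p ↔
      ∃ j, curvature b r (b j) p = μ := by
  refine ⟨fun h => ?_, ?_⟩
  · obtain ⟨u, hu, h0⟩ := h.exists_hasEigenvector
    by_contra! hj
    exact h0 (PiLp.ext fun j =>
      ((mem_principalSpace_tube b hb p u μ).1 hu j).resolve_left (hj j))
  · rintro ⟨j, rfl⟩
    refine Module.End.hasEigenvalue_of_hasEigenvector
      (x := (EuclideanSpace.single j 1 : EuclideanSpace ℝ (Fin n))) ⟨?_, ?_⟩
    · refine (mem_principalSpace_curvature b hb p _ (hb j)).2 fun l hl => ?_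
      rw [PiLp.single_apply, if_neg]
      rintro rfl
      exact hl rfl
    · exact (PiLp.single_eq_zero_iff 2 j).not.2 one_ne_zero

theorem principalMultiplicity_tube {r : ℕ} (hb : ∀ j, b j < r) (p : EuclideanSpace ℝ (Fin n))
    {i : ℕ} (hi : i < r) :
    principalMultiplicity (tube b r) (tubeNormal b r) p (curvature b r i p) =
      Fintype.card {j // b j = i} := by
  let W : Submodule ℝ (EuclideanSpace ℝ (Fin n)) :=
    principalSpace (tube b r) (tubeNormal b r) p (curvature b r i p)
  have hW : ∀ u, u ∈ W ↔ ∀ j, b j ≠ i → u j = 0 :=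
    fun u => mem_principalSpace_curvature b hb p u hi
  let e : W ≃ₗ[ℝ] ({j // b j = i} → ℝ) :=
    { toFun := fun u j => u.1 j
      map_add' := fun _ _ => rfl
      map_smul' := fun _ _ => rfl
      invFun := fun f => ⟨WithLp.toLp 2 fun j => if h : b j = i then f ⟨j, h⟩ else 0,
        (hW _).2 fun j hj => by simp [hj]⟩
      left_inv := fun u => Subtype.ext <| PiLp.ext fun j => by
        by_cases h : b j = i
        · simp [h]
        · simp [h, (hW _).1 u.2 j h]
      right_inv := fun f => funext fun j => by simp [j.2] }
  exact e.finrank_eq.trans (Module.finrank_fintype_fun_eq_card ℝ)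

/-! ### Functions with vanishing differential on a manifold -/

section
variable {k : ℕ} {S : Type*} [TopologicalSpace S] [ChartedSpace (EuclideanSpace ℝ (Fin k)) S]
  [IsManifold (𝓡 k) ∞ S] {f : S → ℝ}

/-- The complement is the image of the open set `{df ≠ 0}` of the tangent bundle under the bundle
projection, which is open. -/
theorem isClosed_setOf_mfderiv_eq_zero (hf : ContMDiff (𝓡 k) 𝓘(ℝ, ℝ) ∞ f) :
    IsClosed {q | mfderiv (𝓡 k) 𝓘(ℝ, ℝ) f q = 0} := by
  have : IsManifold (𝓡 k) 1 S := IsManifold.of_le (n := ∞) (by simp)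
  have hc : Continuous fun w : TangentBundle (𝓡 k) S => mfderiv (𝓡 k) 𝓘(ℝ, ℝ) f w.1 w.2 :=
    ((tangentBundleModelSpaceHomeomorph 𝓘(ℝ, ℝ)).continuous.comp
      (hf.continuous_tangentMap (by simp))).snd
  have ho := FiberBundle.isOpenMap_proj (EuclideanSpace ℝ (Fin k)) (TangentSpace (𝓡 k) (M := S)) _
    (isOpen_compl_singleton.preimage hc : IsOpen (_ ⁻¹' {(0 : ℝ)}ᶜ))
  rw [← isOpen_compl_iff]
  convert ho using 1
  ext q
  simp only [Set.mem_compl_iff, Set.mem_ofPred_eq, Set.mem_image]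
  constructor
  · intro h
    by_contra! h'
    exact h (ContinuousLinearMap.ext fun w => by
      by_contra hw
      exact h' ⟨q, w⟩ hw rfl)
  · rintro ⟨w, hw, rfl⟩ h
    exact hw (by
      refine (congrArg (fun L : EuclideanSpace ℝ (Fin k) →L[ℝ] ℝ => L w.2) h).trans ?_
      rfl)

theorem isLocallyConstant_of_mfderiv_eq_zero (hf : ContMDiff (𝓡 k) 𝓘(ℝ, ℝ) ∞ f)
    (h : ∀ q, mfderiv (𝓡 k) 𝓘(ℝ, ℝ) f q = 0) : IsLocallyConstant f := by
  have : IsManifold (𝓡 k) 1 S := IsManifold.of_le (n := ∞) (by simp)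
  refine (IsLocallyConstant.iff_exists_open f).2 fun q => ?_
  let e := chartAt (EuclideanSpace ℝ (Fin k)) q
  have hd : ∀ y ∈ e.target,
      HasFDerivAt (f ∘ e.symm) (0 : EuclideanSpace ℝ (Fin k) →L[ℝ] ℝ) y := by
    intro y hy
    have h1 : MDifferentiableAt (𝓡 k) (𝓡 k) e.symm y :=
      (contMDiffOn_chart_symm (n := 1) (I := 𝓡 k) (x := q)).contMDiffAt
        (e.open_target.mem_nhds hy) |>.mdifferentiableAt (by simp)
    have hm : MDifferentiableAt (𝓡 k) 𝓘(ℝ, ℝ) f (e.symm y) :=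
      (hf (e.symm y)).mdifferentiableAt (by simp)
    have h2 := hm.hasMFDerivAt.comp y h1.hasMFDerivAt
    rw [h] at h2
    have h3 : HasMFDerivAt (𝓡 k) 𝓘(ℝ, ℝ) (f ∘ e.symm) y
        (0 : EuclideanSpace ℝ (Fin k) →L[ℝ] ℝ) := h2.congr_mfderiv (ContinuousLinearMap.zero_comp _)
    exact h3.hasFDerivAt
  have hopen := e.open_target.isOpen_inter_preimage_of_fderiv_eq_zero (𝕜 := ℝ)
    (fun y hy => (hd y hy).differentiableAt.differentiableWithinAt)
    (fun y hy => (hd y hy).fderiv) {f q}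
  refine ⟨e.source ∩ e ⁻¹' (e.target ∩ (f ∘ e.symm) ⁻¹' {f q}),
    e.isOpen_inter_preimage hopen, ⟨mem_chart_source _ q, ?_⟩, ?_⟩
  · exact ⟨e.map_source (mem_chart_source _ q), by
      simp [e, e.left_inv (mem_chart_source _ q)]⟩
  · rintro q' ⟨hs, -, hq'⟩
    simpa [e.left_inv hs] using hq'

end

/-! ### The Dupin property -/

theorem isDupin_tube {r : ℕ} (hb : ∀ j, b j < r) : IsDupin (tube b r) (tubeNormal b r) := by
  intro k S _ _ ι μ hS
  have := hS.isManifold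
  have := hS.connected
  have hι : ∀ j, ContMDiff (𝓡 k) 𝓘(ℝ, ℝ) ∞ fun q => ι q j := fun j =>
    (EuclideanSpace.proj j : EuclideanSpace ℝ (Fin n) →L[ℝ] ℝ).contMDiff.comp hS.smooth
  let D : S → EuclideanSpace ℝ (Fin k) →L[ℝ] EuclideanSpace ℝ (Fin n) := fun q =>
    mfderiv (𝓡 k) (𝓡 n) ι q
  have hdι : ∀ (j : Fin n) (q : S) (w : EuclideanSpace ℝ (Fin k)),
      mfderiv (𝓡 k) 𝓘(ℝ, ℝ) (fun q => ι q j) q w = D q w j := by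
    intro j q w
    have hj := (EuclideanSpace.proj j : EuclideanSpace ℝ (Fin n) →L[ℝ] ℝ).hasMFDerivAt
      (x := ι q)
    have hq : MDifferentiableAt (𝓡 k) (𝓡 n) ι q := (hS.smooth q).mdifferentiableAt (by simp)
    exact congrArg (fun L : EuclideanSpace ℝ (Fin k) →L[ℝ] ℝ => L w)
      (hj.comp q hq.hasMFDerivAt).mfderiv
  -- `Z i` is where the surface is tangent to block `i`. As `μ` is not assumed continuous, constancy
  -- of the block index comes from these closed sets: finitely many, disjoint and covering, hence
  -- clopen.
  let Z : Fin r → Set S := fun i =>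
    ⋂ j : {j // b j ≠ i}, {q | mfderiv (𝓡 k) 𝓘(ℝ, ℝ) (fun q => ι q j) q = 0}
  have hZ : ∀ i, IsClosed (Z i) := fun i =>
    isClosed_iInter fun j => isClosed_setOf_mfderiv_eq_zero (hι j)
  have hcover : ∀ q, ∃ i : Fin r, q ∈ Z i ∧ μ q = curvature b r i (ι q) := by
    intro q
    obtain ⟨j, hj⟩ := (mem_principalCurvatures_tube b hb _ _).1 (hS.isPrincipal q)
    refine ⟨⟨b j, hb j⟩, Set.mem_iInter.2 fun l => ?_, hj.symm⟩
    refine ContinuousLinearMap.ext fun w => (hdι l q w).trans ?_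
    have hw : D q w ∈
        principalSpace (tube b r) (tubeNormal b r) (ι q) (curvature b r (b j) (ι q)) := by
      rw [hj, ← hS.tangent q]
      exact ⟨w, rfl⟩
    exact (mem_principalSpace_curvature b hb _ _ (hb j)).1 hw l l.2
  have hunique : ∀ q i i', q ∈ Z i → q ∈ Z i' → i = i' := by
    intro q i i' hi hi'
    by_contra hne
    -- Tangency to two different blocks would kill every coordinate of the differential, yet its
    -- range is a nonzero principal space.
    have hzero : ∀ w : EuclideanSpace ℝ (Fin k), D q w = 0 := by
      intro w
      refine PiLp.ext fun j => ?_
      have hj : mfderiv (𝓡 k) 𝓘(ℝ, ℝ) (fun q => ι q j) q = 0 := by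
        by_cases h : b j = i
        · exact Set.mem_iInter.1 hi' ⟨j, fun h' => hne (Fin.ext (h.symm.trans h'))⟩
        · exact Set.mem_iInter.1 hi ⟨j, h⟩
      exact (hdι j q w).symm.trans
        (congrArg (fun L : EuclideanSpace ℝ (Fin k) →L[ℝ] ℝ => L w) hj)
    obtain ⟨u, hu, h0⟩ := (hS.isPrincipal q).exists_hasEigenvector
    have hu' : u ∈ principalSpace (tube b r) (tubeNormal b r) (ι q) (μ q) := hu
    rw [← hS.tangent q] at hu'
    obtain ⟨w, rfl⟩ := hu'
    exact h0 (hzero w)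
  intro q q'
  obtain ⟨i, hqi, hμ⟩ := hcover q
  have hclopen : IsClopen (Z i) := by
    refine ⟨hZ i, ?_⟩
    have hcompl : (Z i)ᶜ = ⋃ i' : {i' // i' ≠ i}, Z i' := by
      ext s
      rw [Set.mem_compl_iff, Set.mem_iUnion]
      constructor
      · intro hs
        obtain ⟨i', hi', -⟩ := hcover s
        exact ⟨⟨i', fun h => hs (h ▸ hi')⟩, hi'⟩
      · rintro ⟨i', hi'⟩ hs
        exact i'.2 (hunique s _ _ hi' hs)
    rw [← isClosed_compl_iff, hcompl]
    exact isClosed_iUnion_of_finite fun i' => hZ i'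
  have huniv : ∀ s, s ∈ Z i := fun s => hclopen.eq_univ ⟨q, hqi⟩ ▸ Set.mem_univ s
  obtain ⟨i', hqi', hμ'⟩ := hcover q'
  obtain rfl := hunique q' i i' (huniv q') hqi'
  rw [hμ, hμ', curvature, curvature, radius_congr b r i fun j hj => ?_]
  exact (isLocallyConstant_of_mfderiv_eq_zero (hι j)
    fun s => Set.mem_iInter.1 (huniv s) ⟨j, hj⟩).apply_eq_of_isPreconnected
      isPreconnected_univ (Set.mem_univ q) (Set.mem_univ q')

end Lorentz
end

/-! ### Choice of blocks and conclusion -/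

theorem mainTheorem6 (n r : ℕ) (hr : 1 ≤ r) (v : Fin r → ℕ) (hv : ∀ i, 0 < v i)
    (hsum : ∑ i, v i = n) :
    ∃ (M : Type) (_ : TopologicalSpace M) (_ : ChartedSpace (EuclideanSpace ℝ (Fin n)) M),
      IsManifold (𝓡 n) ∞ M ∧ T2Space M ∧ SecondCountableTopology M ∧ ConnectedSpace M ∧
      ∃ x N : M → Lorentz.LorentzSpace n,
        Lorentz.IsSpacelikeHypersurface x ∧ Lorentz.IsUnitNormal x N ∧
        Lorentz.IsProperDupin x N ∧
        ∃ κ : Fin r → M → ℝ,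
          (∀ i, ContMDiff (𝓡 n) 𝓘(ℝ, ℝ) ∞ (κ i)) ∧
          ∀ p : M,
            Function.Injective (fun i => κ i p) ∧
            Lorentz.principalCurvatures x N p = Set.range (fun i => κ i p) ∧
            ∀ i, Lorentz.principalMultiplicity x N p (κ i p) = v i := by
  subst hsum
  let block : Fin (∑ i, v i) → Fin r := fun j => (finSigmaFinEquiv.symm j).1
  let b : Fin (∑ i, v i) → ℕ := fun j => block j
  have hb : ∀ j, b j < r := fun j => (block j).2
  have hcard : ∀ i : Fin r, Fintype.card {j // b j = i} = v i := by
    intro i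
    have e : {j // b j = i} ≃ Fin (v i) :=
      (finSigmaFinEquiv.symm.subtypeEquiv (q := fun s => s.1 = i) fun j => Fin.ext_iff.symm).trans
        (Equiv.sigmaSubtype i)
    simpa using Fintype.card_congr e
  have hinj : ∀ p, Function.Injective fun i : Fin r => Lorentz.curvature b r i p :=
    fun p i i' h => Fin.ext (Lorentz.curvature_injOn b r p i.2 i'.2 h)
  have hrange : ∀ p, Lorentz.principalCurvatures (Lorentz.tube b r) (Lorentz.tubeNormal b r) p =
      Set.range fun i : Fin r => Lorentz.curvature b r i p := by
    intro p
    ext μ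
    rw [Lorentz.mem_principalCurvatures_tube b hb]
    constructor
    · rintro ⟨j, hj⟩
      exact ⟨block j, hj⟩
    · rintro ⟨i, hi⟩
      -- The first coordinate of block `i`, which exists because `v i > 0`.
      refine ⟨finSigmaFinEquiv ⟨i, 0, hv i⟩, ?_⟩
      simpa [b, block] using hi
  refine ⟨EuclideanSpace ℝ (Fin (∑ i, v i)), inferInstance, inferInstance, inferInstance,
    inferInstance, inferInstance, inferInstance, Lorentz.tube b r, Lorentz.tubeNormal b r,
    Lorentz.isSpacelikeHypersurface_tube b hb, Lorentz.isUnitNormal_tube b r,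
    ⟨Lorentz.isDupin_tube b hb, r, fun p => ?_⟩, fun i => Lorentz.curvature b r i,
    fun i => (Lorentz.contDiff_curvature b i.2).contMDiff,
    fun p => ⟨hinj p, hrange p, fun i => ?_⟩⟩
  · rw [hrange p, ← Set.image_univ, (hinj p).encard_image, Set.encard_univ]
    simp
  · rw [Lorentz.principalMultiplicity_tube b hb p i.2, hcard i]
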